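/- All categories are locally small. A functor $P\colon \mathcal A\to\mathbf{Set}$ is called small if it is the colimit in $[\mathcal A,\mathbf{Set}]$ of a small diagram of representable functors, and a functor $G\colon\mathcal A\to\mathcal B$ is called representably small if $\mathcal B(b,G-)\colon\mathcal A\to\mathbf{Set}$ is small for every object $b$ of $\mathcal B$. For a monad $T$ on $\mathcal A$, the pushforward $G_\#T$ is the right Kan extension of $GT$ along $G$, when it exists, with counit $\varepsilon\colon (G_\#T)G\Rightarrow GT$, equipped with the unique monad structure for which $$\varepsilon\cdot \eta^{G_\#T}G=G\eta^T,\qquad \varepsilon\cdot\mu^{G_\#T}G=G\mu^T\cdot\varepsilon T\cdot (G_\#T)\varepsilon .$$ Let $G\colon\mathcal A\to\mathcal B$ be a representably small functor into a complete category $\mathcal B$, let $T$ be a monad on $\mathcal A$, and suppose that the Eilenberg–Moore category $\mathcal A^T$ has all finite connected colimits. Then $G_\#T$ exists. Moreover, for any choice of the right Kan extension defining $G_\#T$, with counit $\varepsilon$, the functor $$G'\colon \mathcal A^T\to\mathcal B^{G_\#T},\qquad (X,\ TX\xrightarrow{a}X)\mapsto \bigl(GX,\ (G_\#T)GX\xrightarrow{\varepsilon_X}GTX\xrightarrow{Ga}GX\bigr),\qquad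 f\mapsto Gf,$$ which satisfies $U^{G_\#T}G'=GU^T$ (where $U^T$ and $U^{G_\#T}$ are the forgetful functors), is again a representably small functor into a complete category; that is, $\mathcal B^{G_\#T}$ is complete and $G'$ is representably small. Consequently the construction can be iterated: the pushforward $G'_\#T'$ exists for every monad $T'$ on $\mathcal A^T$. -/

import Mathlib

open CategoryTheory CategoryTheory.Limits

universe v u₁ u₂

namespace PushforwardMonad

section Smallness

variable {A : Type u₁} [Category.{v} A] {B : Type u₂} [Category.{v} B]

/-- A functor `P : A ⥤ Set` on a locally small category is *small* if it is a colimit, in the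
category of functors `A ⥤ Set`, of a small diagram of representable functors, i.e. of functors
isomorphic to some `A(a, -)`. -/
def IsSmallFunctor (P : A ⥤ Type v) : Prop :=
  ∃ (J : Type v) (_ : SmallCategory J) (p : ColimitPresentation J P),
    ∀ j : J, (p.diag.obj j).IsCorepresentable

/-- A functor `G : A ⥤ B` is *representably small* if `B(b, G-) : A ⥤ Set` is small for every
object `b` of `B`. -/
def RepresentablySmall (G : A ⥤ B) : Prop :=
  ∀ b : B, IsSmallFunctor (G ⋙ coyoneda.obj (Opposite.op b))

end Smallness

/-- A category has finite connected colimits if it has colimits of all diagrams indexed by a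
finite connected (in particular nonempty) category. -/
def HasFiniteConnectedColimits (C : Type u₁) [Category.{v} C] : Prop :=
  ∀ (J : Type) [SmallCategory J] [FinCategory J] [IsConnected J], HasColimitsOfShape J C

section Lax

variable {A : Type u₁} [Category.{v} A] {B : Type u₂} [Category.{v} B]

/-- A lax transformation of monads from `T` (on `A`) to `S` (on `B`) with underlying functor `G`:
a natural transformation `φ : SG ⟶ GT` compatible with units and multiplications. -/
structure LaxTransformation (T : Monad A) (S : Monad B) (G : A ⥤ B) where
  φ : G ⋙ S.toFunctor ⟶ T.toFunctor ⋙ G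
  unit : ∀ X : A, S.η.app (G.obj X) ≫ φ.app X = G.map (T.η.app X)
  mul : ∀ X : A, S.μ.app (G.obj X) ≫ φ.app X =
    S.map (φ.app X) ≫ φ.app (T.obj X) ≫ G.map (T.μ.app X)

/-- The functor `A^T ⥤ B^S` between Eilenberg-Moore categories corresponding to a lax
transformation `(G, φ)`; it sends `(X, a)` to `(G X, G a ∘ φ_X)`. -/
def LaxTransformation.lift {T : Monad A} {S : Monad B} {G : A ⥤ B}
    (L : LaxTransformation T S G) : T.Algebra ⥤ S.Algebra where
  obj X :=
    { A := G.obj X.A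
      a := L.φ.app X.A ≫ G.map X.a
      unit := by
        rw [← Category.assoc, L.unit, ← G.map_comp, X.unit]
        exact G.map_id _
      assoc := by
        have h := L.φ.naturality X.a
        simp only [Functor.comp_map] at h
        rw [← Category.assoc, L.mul]
        simp only [Category.assoc, Functor.map_comp]
        rw [reassoc_of% h, ← G.map_comp, X.assoc, G.map_comp] }
  map {X Y} f :=
    { f := G.map f.f
      h := by
        have h := L.φ.naturality f.f
        simp only [Functor.comp_map] at h
        change S.map (G.map f.f) ≫ L.φ.app Y.A ≫ G.map Y.a = (L.φ.app X.A ≫ G.map X.a) ≫ G.map f.f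
        rw [reassoc_of% h, Category.assoc, ← G.map_comp, f.h, G.map_comp] }
  map_id X := by
    ext
    exact G.map_id _
  map_comp f g := by
    ext
    exact G.map_comp _ _

/-- The lifted functor makes the square with the forgetful functors commute strictly. -/
theorem LaxTransformation.lift_comp_forget {T : Monad A} {S : Monad B} {G : A ⥤ B}
    (L : LaxTransformation T S G) : L.lift ⋙ S.forget = T.forget ⋙ G := rfl

end Lax

section Pushforward

variable {A : Type u₁} [Category.{v} A] {B : Type u₂} [Category.{v} B]
variable (G : A ⥤ B) (T : Monad A) (R : B ⥤ B) (ε : G ⋙ R ⟶ T.toFunctor ⋙ G)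

/-- The transformation `G ⟶ GT` inducing the unit of the pushforward monad. -/
def unitAux : G ⋙ 𝟭 B ⟶ T.toFunctor ⋙ G where
  app X := G.map (T.η.app X)
  naturality X Y f := by
    have h := T.η.naturality f
    simp only [Functor.id_map] at h
    simp only [Functor.comp_map, Functor.id_map]
    rw [← G.map_comp, ← G.map_comp, h]

/-- The transformation `RRG ⟶ RGT ⟶ GTT ⟶ GT` inducing the multiplication of the pushforward
monad. -/
def mulAux : G ⋙ R ⋙ R ⟶ T.toFunctor ⋙ G where
  app X := R.map (ε.app X) ≫ ε.app (T.obj X) ≫ G.map (T.μ.app X)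
  naturality X Y f := by
    have h₁ := ε.naturality f
    have h₂ := ε.naturality (T.map f)
    have h₃ := T.μ.naturality f
    simp only [Functor.comp_map] at h₁ h₂ h₃
    simp only [Functor.comp_map, Category.assoc]
    rw [← R.map_comp_assoc, h₁, R.map_comp_assoc, reassoc_of% h₂, ← G.map_comp, h₃, G.map_comp]

variable [R.IsRightKanExtension ε]

/-- The unit of the pushforward monad. -/
noncomputable def pushforwardUnit : 𝟭 B ⟶ R :=
  R.liftOfIsRightKanExtension ε (𝟭 B) (unitAux G T)

/-- The multiplication of the pushforward monad. -/
noncomputable def pushforwardMul : R ⋙ R ⟶ R :=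
  R.liftOfIsRightKanExtension ε (R ⋙ R) (mulAux G T R ε)

theorem pushforwardUnit_fac (X : A) :
    (pushforwardUnit G T R ε).app (G.obj X) ≫ ε.app X = G.map (T.η.app X) :=
  R.liftOfIsRightKanExtension_fac_app ε (𝟭 B) (unitAux G T) X

theorem pushforwardMul_fac (X : A) :
    (pushforwardMul G T R ε).app (G.obj X) ≫ ε.app X =
      R.map (ε.app X) ≫ ε.app (T.obj X) ≫ G.map (T.μ.app X) :=
  R.liftOfIsRightKanExtension_fac_app ε (R ⋙ R) (mulAux G T R ε) X

/-- The *pushforward* `G_# T` of the monad `T` along `G`, formed from a right Kan extension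
`(R, ε)` of `GT` along `G`: its endofunctor is `R`, and its unit and multiplication are the unique
ones compatible with `ε` and with the structure of `T`. -/
noncomputable def pushforward : Monad B where
  toFunctor := R
  η := pushforwardUnit G T R ε
  μ := pushforwardMul G T R ε
  assoc := by
    have h : (Functor.whiskerRight (pushforwardMul G T R ε) R ≫ pushforwardMul G T R ε :
        (R ⋙ R) ⋙ R ⟶ R) =
        Functor.whiskerLeft R (pushforwardMul G T R ε) ≫ pushforwardMul G T R ε := by
      refine R.hom_ext_of_isRightKanExtension ε _ _ ?_
      ext X
      have n₁ := (pushforwardMul G T R ε).naturality (ε.app X)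
      have n₂ := ε.naturality (T.μ.app X)
      have h₁ := pushforwardMul_fac G T R ε X
      have h₂ := pushforwardMul_fac G T R ε (T.obj X)
      have h₃ := T.assoc X
      simp only [Functor.comp_map] at n₁ n₂
      change (R.map _ ≫ (pushforwardMul G T R ε).app _) ≫ ε.app X =
        ((pushforwardMul G T R ε).app _ ≫ (pushforwardMul G T R ε).app _) ≫ ε.app X
      rw [Category.assoc, Category.assoc, h₁, ← R.map_comp_assoc, h₁]
      simp only [Functor.map_comp, Category.assoc]
      rw [reassoc_of% n₂, ← G.map_comp, h₃, ← reassoc_of% n₁, reassoc_of% h₂, G.map_comp]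
    exact fun X => NatTrans.congr_app h X
  left_unit := by
    have h : (Functor.whiskerLeft R (pushforwardUnit G T R ε) ≫ pushforwardMul G T R ε :
        R ⟶ R) = 𝟙 R := by
      refine R.hom_ext_of_isRightKanExtension ε _ _ ?_
      ext X
      have n₁ := (pushforwardUnit G T R ε).naturality (ε.app X)
      have h₁ := pushforwardMul_fac G T R ε X
      have h₂ := pushforwardUnit_fac G T R ε (T.obj X)
      have h₃ := T.left_unit X
      simp only [Functor.id_map] at n₁
      change ((pushforwardUnit G T R ε).app _ ≫ (pushforwardMul G T R ε).app _) ≫ ε.app X =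
        𝟙 _ ≫ ε.app X
      rw [Category.assoc, h₁, ← reassoc_of% n₁, reassoc_of% h₂, ← G.map_comp, h₃, Category.id_comp]
      exact (congrArg (fun z => ε.app X ≫ z) (G.map_id _)).trans (Category.comp_id _)
    exact fun X => NatTrans.congr_app h X
  right_unit := by
    have h : (Functor.whiskerRight (pushforwardUnit G T R ε) R ≫ pushforwardMul G T R ε :
        R ⟶ R) = 𝟙 R := by
      refine R.hom_ext_of_isRightKanExtension ε _ _ ?_
      ext X
      have n₁ := ε.naturality (T.η.app X)
      have h₁ := pushforwardMul_fac G T R ε X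
      have h₂ := pushforwardUnit_fac G T R ε X
      have h₃ := T.right_unit X
      simp only [Functor.comp_map] at n₁
      change (R.map _ ≫ (pushforwardMul G T R ε).app _) ≫ ε.app X = 𝟙 _ ≫ ε.app X
      rw [Category.assoc, h₁, ← R.map_comp_assoc, h₂, reassoc_of% n₁, ← G.map_comp, h₃, Category.id_comp]
      exact (congrArg (fun z => ε.app X ≫ z) (G.map_id _)).trans (Category.comp_id _)
    exact fun X => NatTrans.congr_app h X

/-- The counit `ε` is a lax transformation from `T` to its pushforward. -/
noncomputable def counitLax : LaxTransformation T (pushforward G T R ε) G where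
  φ := ε
  unit := pushforwardUnit_fac G T R ε
  mul := pushforwardMul_fac G T R ε

/-- The functor `G' : A^T ⥤ B^{G_# T}` over `G` corresponding to the counit of the pushforward. -/
noncomputable def pushforwardLift : T.Algebra ⥤ (pushforward G T R ε).Algebra :=
  (counitLax G T R ε).lift

end Pushforward

end PushforwardMonad

namespace PushforwardMonad

/-! ### Elements of colimits of set-valued functors. -/

section Presentation

variable {C : Type u₁} [Category.{v} C] {J : Type v} [SmallCategory J] {P : C ⥤ Type v}

/-! A presentation of `B(b, G-)` as a small colimit of representables amounts to a small category
mapping initially to the comma category `b ↓ G` (`universalElements_initial`). Limits over `b ↓ G`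
thus reduce to small ones, so pointwise right Kan extensions along `G` into a complete category
exist. This gives both `G_# T` and, once `G'` is known to be representably small, the iterated
pushforward. Algebras for `G_# T` are complete because the forgetful functor creates limits.

For `G'`, write `S = G_# T`. A map `X ⟶ G'Y` of algebras is a map of underlying objects on which two
maps to `B(SX, GU^T Y)` agree, so `B^S(X, G'-)` is an equalizer of functors `B(b, GU^T -)`. These
are small since `U^T` has a left adjoint. It remains that small functors on a category with pushouts
and coequalizers are closed under equalizers (`IsSmallFunctor.equalizer`): the corepresenting
objects are closed up under these colimits, and the resulting class, still essentially small,
generates the equalizer in the sense of `GeneratedBy`. -/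

/-- Every element of a colimit of set-valued functors comes from one of the functors. -/
theorem presentation_surjective (p : ColimitPresentation J P) (c : C) (z : P.obj c) :
    ∃ (j : J) (y : (p.diag.obj j).obj c), (p.ι.app j).app c y = z :=
  Types.jointly_surjective_of_isColimit
    (isColimitOfPreserves ((evaluation C (Type v)).obj c) p.isColimit) z

/-- Elements identified in a colimit of set-valued functors are connected by a zigzag. -/
theorem presentation_eqvGen (p : ColimitPresentation J P) (c : C) {j j' : J}
    (y : (p.diag.obj j).obj c) (y' : (p.diag.obj j').obj c)
    (h : (p.ι.app j).app c y = (p.ι.app j').app c y') :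
    Relation.EqvGen (p.diag ⋙ (evaluation C (Type v)).obj c).ColimitTypeRel ⟨j, y⟩ ⟨j', y'⟩ := by
  have hc := isColimitOfPreserves ((evaluation C (Type v)).obj c) p.isColimit
  apply Types.colimit_eq
  have h₁ := ConcreteCategory.congr_hom (hc.fac (colimit.cocone _) j) y
  have h₂ := ConcreteCategory.congr_hom (hc.fac (colimit.cocone _) j') y'
  refine h₁.symm.trans (Eq.trans ?_ h₂)
  exact congrArg (hc.desc (colimit.cocone _)) h

/-- The comparison maps in a colimit of set-valued functors are constant along transitions. -/
theorem presentation_ι_eq (p : ColimitPresentation J P) (c : C)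
    {x x' : Σ j, (p.diag ⋙ (evaluation C (Type v)).obj c).obj j}
    (h : (p.diag ⋙ (evaluation C (Type v)).obj c).ColimitTypeRel x x') :
    (p.ι.app x.1).app c x.2 = (p.ι.app x'.1).app c x'.2 := by
  obtain ⟨f, hf⟩ := h
  rw [hf]
  exact (ConcreteCategory.congr_hom (NatTrans.congr_app (p.w f) c) x.2).symm

theorem presentation_ι_eq_of_eqvGen (p : ColimitPresentation J P) (c : C)
    {x x' : Σ j, (p.diag ⋙ (evaluation C (Type v)).obj c).obj j}
    (h : Relation.EqvGen (p.diag ⋙ (evaluation C (Type v)).obj c).ColimitTypeRel x x') :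
    (p.ι.app x.1).app c x.2 = (p.ι.app x'.1).app c x'.2 := by
  induction h with
  | rel _ _ h => exact presentation_ι_eq p c h
  | refl => rfl
  | symm _ _ _ ih => exact ih.symm
  | trans _ _ _ _ _ ih₁ ih₂ => exact ih₁.trans ih₂

end Presentation

/-! ### Small presentations as initial functors, and Kan extensions. -/

section KanExtension

/-- A natural transformation between corepresentable functors is precomposition with a map. -/
theorem corepresentableBy_app_homEquiv {C : Type u₁} [Category.{v} C] {P P' : C ⥤ Type v}
    {a a' c : C} (e : P.CorepresentableBy a) (e' : P'.CorepresentableBy a') (φ : P ⟶ P') (m : a ⟶ c) :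
    φ.app c (e.homEquiv m) =
      e'.homEquiv (e'.homEquiv.symm (φ.app a (e.homEquiv (𝟙 a))) ≫ m) := by
  rw [e'.homEquiv_comp, Equiv.apply_symm_apply, e.homEquiv_eq m, NatTrans.naturality_apply]

variable {A : Type u₁} [Category.{v} A] {B : Type u₂} [Category.{v} B] {G : A ⥤ B} {b : B}
  {J : Type v} [SmallCategory J]

/-- The universal elements of a presentation of `B(b, G-)` by corepresentable functors, organised
into a functor to the comma category `b ↓ G`. -/
def universalElements (p : ColimitPresentation J (G ⋙ coyoneda.obj (Opposite.op b))) (a : J → A)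
    (e : ∀ j, (p.diag.obj j).CorepresentableBy (a j)) : Jᵒᵖ ⥤ StructuredArrow b G where
  obj j := StructuredArrow.mk (Y := a j.unop)
    ((p.ι.app j.unop).app (a j.unop) ((e j.unop).homEquiv (𝟙 _)))
  map {j j'} k := StructuredArrow.homMk
    ((e j.unop).homEquiv.symm ((p.diag.map k.unop).app _ ((e j'.unop).homEquiv (𝟙 _)))) (by
      have h₁ := NatTrans.naturality_apply (p.ι.app j.unop)
        ((e j.unop).homEquiv.symm ((p.diag.map k.unop).app _ ((e j'.unop).homEquiv (𝟙 _))))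
        ((e j.unop).homEquiv (𝟙 _))
      rw [← Functor.CorepresentableBy.homEquiv_eq, Equiv.apply_symm_apply] at h₁
      refine Eq.trans h₁.symm ?_
      exact ConcreteCategory.congr_hom (NatTrans.congr_app (p.w k.unop) _) _)
  map_id j := by
    ext
    simp
  map_comp {j j' j''} k l := by
    ext
    apply (e j.unop).homEquiv.injective
    refine Eq.trans ?_ (corepresentableBy_app_homEquiv (e j'.unop) (e j.unop) (p.diag.map k.unop) _)
    simp

/-- By Yoneda, an object over `X` is an index `j` with an element of the `j`-th functor at `X.right`
that maps to `X.hom`. Surjectivity of the colimit makes such objects exist; the zigzag description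
of equality in the colimit connects them. -/
theorem universalElements_initial
    (p : ColimitPresentation J (G ⋙ coyoneda.obj (Opposite.op b))) (a : J → A)
    (e : ∀ j, (p.diag.obj j).CorepresentableBy (a j)) :
    (universalElements p a e).Initial where
  out X := by
    have key (j : J) (m : a j ⟶ X.right) :
        (p.ι.app j).app X.right ((e j).homEquiv m) =
          (p.ι.app j).app (a j) ((e j).homEquiv (𝟙 _)) ≫ G.map m := by
      rw [Functor.CorepresentableBy.homEquiv_eq]
      exact NatTrans.naturality_apply (p.ι.app j) m _
    let ob (x : Σ j, (p.diag ⋙ (evaluation A (Type v)).obj X.right).obj j)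
        (hx : (p.ι.app x.1).app X.right x.2 = X.hom) :
        CostructuredArrow (universalElements p a e) X :=
      CostructuredArrow.mk (Y := Opposite.op x.1)
        (StructuredArrow.homMk ((e x.1).homEquiv.symm x.2) (by
          refine (key x.1 _).symm.trans ?_
          rw [Equiv.apply_symm_apply]
          exact hx))
    have zz (x y) (h : Relation.EqvGen
        (p.diag ⋙ (evaluation A (Type v)).obj X.right).ColimitTypeRel x y)
        (hx : (p.ι.app x.1).app X.right x.2 = X.hom)
        (hy : (p.ι.app y.1).app X.right y.2 = X.hom) : Zigzag (ob x hx) (ob y hy) := by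
      induction h with
      | rel x y h =>
        obtain ⟨k, hk⟩ := h
        -- The indexing category is `Jᵒᵖ`, so the transition `k` gives a morphism in the reverse
        -- direction.
        refine Zigzag.of_inv (CostructuredArrow.homMk k.op ?_)
        ext
        apply (e y.1).homEquiv.injective
        refine (corepresentableBy_app_homEquiv (e x.1) (e y.1) (p.diag.map k) _).symm.trans ?_
        change (p.diag.map k).app X.right ((e x.1).homEquiv ((e x.1).homEquiv.symm x.2)) =
          (e y.1).homEquiv ((e y.1).homEquiv.symm y.2)
        rw [Equiv.apply_symm_apply, Equiv.apply_symm_apply]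
        exact hk.symm
      | refl => exact Zigzag.refl _
      | symm _ _ _ ih => exact (ih hy hx).symm
      | trans x y z h₁ h₂ ih₁ ih₂ =>
        have hm := (presentation_ι_eq_of_eqvGen p X.right h₁).symm.trans hx
        exact (ih₁ hx hm).trans (ih₂ hm hy)
    have hob (f : CostructuredArrow (universalElements p a e) X) :
        ∃ x hx, f = ob x hx := by
      refine ⟨⟨f.left.unop, (e _).homEquiv f.hom.right⟩,
        (key _ _).trans (StructuredArrow.w f.hom), ?_⟩
      rw [CostructuredArrow.eq_mk f]
      congr 1
      ext
      exact ((e _).homEquiv.symm_apply_apply _).symm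
    have : Nonempty (CostructuredArrow (universalElements p a e) X) := by
      obtain ⟨j, y, hy⟩ := presentation_surjective p X.right X.hom
      exact ⟨ob ⟨j, y⟩ hy⟩
    refine zigzag_isConnected fun f g => ?_
    obtain ⟨x, hx, rfl⟩ := hob f
    obtain ⟨y, hy, rfl⟩ := hob g
    exact zz x y (presentation_eqvGen p _ _ _ (hx.trans hy.symm)) hx hy

/-- Functors into a complete category have right Kan extensions along a representably small
functor. -/
theorem RepresentablySmall.hasRightKanExtension {C : Type*} [Category.{v} C]
    (hG : RepresentablySmall G) [HasLimits C] (H : A ⥤ C) : G.HasRightKanExtension H := by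
  have (b : B) : G.HasPointwiseRightKanExtensionAt H b := by
    obtain ⟨J, _, p, hp⟩ := hG b
    choose a e using fun j => (hp j).has_corepresentation
    have := universalElements_initial p a (fun j => (e j).some)
    exact Functor.Initial.hasLimit_of_comp (universalElements p a (fun j => (e j).some))
  have : G.HasPointwiseRightKanExtension H := this
  infer_instance

end KanExtension

/-! ### Generating classes, and equalizers of small functors. -/

section Closure

variable {C : Type u₁} [Category.{v} C]

/-- A functor `P : C ⥤ Set` is generated by a class `D` of objects if it is the left Kan extension
of its restriction to `D`, in the strong sense that zigzags between elements over `D` can be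
replaced by cospans. -/
structure GeneratedBy (D : ObjectProperty C) (P : C ⥤ Type v) : Prop where
  cover : ∀ (c : C) (z : P.obj c), ∃ (d : C) (_ : D d) (x : P.obj d) (f : d ⟶ c), P.map f x = z
  join : ∀ (c d d' : C) (_ : D d) (_ : D d') (x : P.obj d) (x' : P.obj d') (f : d ⟶ c)
    (f' : d' ⟶ c), P.map f x = P.map f' x' →
      ∃ (t : C) (_ : D t) (h : d ⟶ t) (h' : d' ⟶ t) (k : t ⟶ c),
        h ≫ k = f ∧ h' ≫ k = f' ∧ P.map h x = P.map h' x'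

theorem GeneratedBy.of_le_isoClosure {D Q : ObjectProperty C} {P : C ⥤ Type v}
    (hP : GeneratedBy D P) (hQD : Q ≤ D) (hDQ : D ≤ Q.isoClosure) : GeneratedBy Q P where
  cover c z := by
    obtain ⟨d, hd, x, f, rfl⟩ := hP.cover c z
    obtain ⟨q, hq, ⟨i⟩⟩ := hDQ d hd
    exact ⟨q, hq, P.map i.hom x, i.inv ≫ f, by
      rw [← Functor.map_comp_apply, Iso.hom_inv_id_assoc]⟩
  join c d d' hd hd' x x' f f' h := by
    obtain ⟨t, ht, m, m', k, rfl, rfl, e⟩ := hP.join c d d' (hQD _ hd) (hQD _ hd') x x' f f' h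
    obtain ⟨q, hq, ⟨i⟩⟩ := hDQ t ht
    exact ⟨q, hq, m ≫ i.hom, m' ≫ i.hom, i.inv ≫ k, by simp, by simp, by simp [e]⟩

/-- A functor generated by a small class of objects is a small colimit of representables. -/
theorem GeneratedBy.isSmallFunctor {D : ObjectProperty C} [ObjectProperty.EssentiallySmall.{v} D]
    {P : C ⥤ Type v} (hP : GeneratedBy D P) : IsSmallFunctor P := by
  obtain ⟨Q, _, hQD, hDQ⟩ := ObjectProperty.EssentiallySmall.exists_small_le.{v} D
  replace hP := hP.of_le_isoClosure hQD hDQ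
  let I := Shrink.{v} (Subtype Q)
  let o (i : I) : Subtype Q := (equivShrink _).symm i
  let el (s : Σ i : I, P.obj (o i).1) : P.Elementsᵒᵖ := Opposite.op ⟨(o s.1).1, s.2⟩
  have hel (q : C) (hq : Q q) : ∃ i : I, (o i).1 = q := ⟨equivShrink _ ⟨q, hq⟩, by simp [o]⟩
  -- The elements of `P` over the small class `Q` replace the possibly large category of all
  -- elements in the density formula.
  let K := InducedCategory P.Elementsᵒᵖ el
  let diag : K ⥤ C ⥤ Type v := inducedFunctor el ⋙ (CategoryOfElements.π P).op ⋙ coyoneda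
  let ι : diag ⟶ (Functor.const K).obj P :=
    { app s := coyonedaEquiv.symm s.2
      naturality s s' k := by
        refine (coyonedaEquiv_symm_map k.hom.unop.1 s'.2).symm.trans ?_
        rw [k.hom.unop.2]
        rfl }
  refine ⟨K, inferInstance, ⟨diag, ι, ?_⟩, fun j => ?_⟩
  · have cov (c : C) (z : P.obj c) : ∃ (k : K) (f : (o k.1).1 ⟶ c), P.map f k.2 = z := by
      obtain ⟨q, hq, x, f, hf⟩ := hP.cover c z
      obtain ⟨i, rfl⟩ := hel q hq
      exact ⟨⟨i, x⟩, f, hf⟩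
    -- The cospan given by `join` carries a common element, hence a third object of `K` mapping to
    -- both `k` and `k'`.
    have indep (s : Cocone diag) (c : C) (k k' : K) (f : (o k.1).1 ⟶ c) (f' : (o k'.1).1 ⟶ c)
        (h : P.map f k.2 = P.map f' k'.2) : (s.ι.app k).app c f = (s.ι.app k').app c f' := by
      obtain ⟨q, hq, m, m', g, rfl, rfl, hm⟩ := hP.join c _ _ (o k.1).2 (o k'.1).2 k.2 k'.2 f f' h
      obtain ⟨i, rfl⟩ := hel q hq
      let l : K := ⟨i, P.map m k.2⟩
      let φ : l ⟶ k := InducedCategory.homMk (Quiver.Hom.op ⟨m, rfl⟩)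
      let φ' : l ⟶ k' := InducedCategory.homMk (Quiver.Hom.op ⟨m', hm.symm⟩)
      have h₁ := ConcreteCategory.congr_hom (NatTrans.congr_app (s.w φ) c) g
      have h₂ := ConcreteCategory.congr_hom (NatTrans.congr_app (s.w φ') c) g
      exact h₁.trans h₂.symm
    choose ck cf hcf using cov
    exact
      { desc s :=
          { app c := ↾fun z => (s.ι.app (ck c z)).app c (cf c z)
            naturality c c' g := by
              ext z
              refine Eq.trans ?_ (NatTrans.naturality_apply (s.ι.app (ck c z)) g (cf c z))
              refine indep s c' _ _ _ (cf c z ≫ g) ?_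
              rw [hcf, Functor.map_comp_apply, hcf]
              rfl }
        fac s k := by
          ext c f
          refine indep s c _ _ _ _ ?_
          rw [hcf]
          exact coyonedaEquiv_symm_app_apply _ _ _
        uniq s m hm := by
          ext c z
          refine Eq.trans ?_
            (ConcreteCategory.congr_hom (NatTrans.congr_app (hm (ck c z)) c) (cf c z))
          refine congrArg (m.app c) ?_
          exact (hcf c z).symm.trans (coyonedaEquiv_symm_app_apply _ _ _).symm }
  · exact inferInstanceAs (coyoneda.obj _).IsCorepresentable

/-- A colimit of functors corepresented by objects in a class closed under pushouts is generated
by this class. -/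
theorem GeneratedBy.of_presentation {J : Type v} [SmallCategory J] {P : C ⥤ Type v}
    (p : ColimitPresentation J P) (a : J → C) (e : ∀ j, (p.diag.obj j).CorepresentableBy (a j))
    (D : ObjectProperty C) (ha : ∀ j, D (a j)) [HasPushouts C]
    [D.IsClosedUnderColimitsOfShape WalkingSpan] : GeneratedBy D P := by
  have hpush {x y z : C} (f : x ⟶ y) (g : x ⟶ z) (hx : D x) (hy : D y) (hz : D z) :
      D (pushout f g) :=
    D.prop_colimit _ (by rintro (_ | _ | _) <;> assumption)
  have cov (c : C) (z : P.obj c) :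
      ∃ (j : J) (f : a j ⟶ c), (p.ι.app j).app c ((e j).homEquiv f) = z := by
    obtain ⟨j, y, rfl⟩ := presentation_surjective p c z
    exact ⟨j, (e j).homEquiv.symm y, by simp⟩
  have key {j : J} {d c : C} (y : (p.diag.obj j).obj d) (f : d ⟶ c) :
      (p.ι.app j).app c ((p.diag.obj j).map f y) = P.map f ((p.ι.app j).app d y) :=
    NatTrans.naturality_apply (p.ι.app j) f y
  -- A zigzag collapses to a single object of `D` where the two elements lift and already agree in
  -- `P`. Zigzags are composed by a pushout under `a y.1`, which corepresents the functor containing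
  -- the middle element.
  have con (c : C) (x y) (h : Relation.EqvGen
      (p.diag ⋙ (evaluation C (Type v)).obj c).ColimitTypeRel x y) :
      ∃ (t : C) (_ : D t) (w : (p.diag.obj x.1).obj t) (w' : (p.diag.obj y.1).obj t) (k : t ⟶ c),
        (p.diag.obj x.1).map k w = x.2 ∧ (p.diag.obj y.1).map k w' = y.2 ∧
          (p.ι.app x.1).app t w = (p.ι.app y.1).app t w' := by
    induction h with
    | rel x y h =>
      obtain ⟨k, hk⟩ := h
      refine ⟨a x.1, ha _, (e x.1).homEquiv (𝟙 _), (p.diag.map k).app _ ((e x.1).homEquiv (𝟙 _)),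
        (e x.1).homEquiv.symm x.2, ?_, ?_, ?_⟩
      · rw [← Functor.CorepresentableBy.homEquiv_eq, Equiv.apply_symm_apply]
      · rw [← NatTrans.naturality_apply, ← Functor.CorepresentableBy.homEquiv_eq,
          Equiv.apply_symm_apply]
        exact hk.symm
      · exact (ConcreteCategory.congr_hom (NatTrans.congr_app (p.w k) _) _).symm
    | refl x =>
      exact ⟨a x.1, ha _, (e x.1).homEquiv (𝟙 _), (e x.1).homEquiv (𝟙 _),
        (e x.1).homEquiv.symm x.2, by simp [← Functor.CorepresentableBy.homEquiv_eq],
        by simp [← Functor.CorepresentableBy.homEquiv_eq], rfl⟩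
    | symm _ _ _ ih =>
      obtain ⟨t, ht, w, w', k, h₁, h₂, h₃⟩ := ih
      exact ⟨t, ht, w', w, k, h₂, h₁, h₃.symm⟩
    | trans x y z _ _ ih₁ ih₂ =>
      obtain ⟨t, ht, w, w', k, h₁, h₂, h₃⟩ := ih₁
      obtain ⟨t', ht', v, v', k', h₁', h₂', h₃'⟩ := ih₂
      let f := (e y.1).homEquiv.symm w'
      let f' := (e y.1).homEquiv.symm v
      have hf : w' = (p.diag.obj y.1).map f ((e y.1).homEquiv (𝟙 _)) := by
        simp [f, ← Functor.CorepresentableBy.homEquiv_eq]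
      have hf' : v = (p.diag.obj y.1).map f' ((e y.1).homEquiv (𝟙 _)) := by
        simp [f', ← Functor.CorepresentableBy.homEquiv_eq]
      have hk : f ≫ k = f' ≫ k' := by
        apply (e y.1).homEquiv.injective
        rw [(e y.1).homEquiv_comp, (e y.1).homEquiv_comp]
        simp only [f, f', Equiv.apply_symm_apply]
        exact h₂.trans h₁'.symm
      refine ⟨pushout f f', hpush f f' (ha _) ht ht', (p.diag.obj x.1).map (pushout.inl f f') w,
        (p.diag.obj z.1).map (pushout.inr f f') v', pushout.desc k k' hk, ?_, ?_, ?_⟩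
      · rw [← Functor.map_comp_apply, pushout.inl_desc, h₁]
      · rw [← Functor.map_comp_apply, pushout.inr_desc, h₂']
      · rw [key, key, h₃, ← h₃', hf, hf', ← key, ← key, ← Functor.map_comp_apply,
          ← Functor.map_comp_apply, pushout.condition]
  refine ⟨fun c z => ?_, fun c d d' hd hd' x x' f f' h => ?_⟩
  · obtain ⟨j, f, rfl⟩ := cov c z
    refine ⟨a j, ha j, (p.ι.app j).app _ ((e j).homEquiv (𝟙 _)), f, ?_⟩
    rw [← key, ← Functor.CorepresentableBy.homEquiv_eq]
  · obtain ⟨j, g, rfl⟩ := cov d x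
    obtain ⟨j', g', rfl⟩ := cov d' x'
    rw [← key, ← key, ← (e j).homEquiv_comp, ← (e j').homEquiv_comp] at h
    obtain ⟨t, ht, w, w', k, h₁, h₂, h₃⟩ := con c _ _ (presentation_eqvGen p c _ _ h)
    dsimp only at w w' h₁ h₂ h₃
    obtain ⟨m, rfl⟩ := (e j).homEquiv.surjective w
    obtain ⟨m', rfl⟩ := (e j').homEquiv.surjective w'
    rw [← (e j).homEquiv_comp] at h₁
    rw [← (e j').homEquiv_comp] at h₂
    replace h₁ := (e j).homEquiv.injective h₁
    replace h₂ := (e j').homEquiv.injective h₂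
    -- `t` receives maps only from `a j` and `a j'`; pushing out along `g`, then along `g'`, makes
    -- it receive maps from `d` and `d'`.
    obtain ⟨k₁, hl, hr⟩ : ∃ k₁ : pushout g m ⟶ c,
        pushout.inl g m ≫ k₁ = f ∧ pushout.inr g m ≫ k₁ = k :=
      ⟨pushout.desc f k h₁.symm, pushout.inl_desc _ _ _, pushout.inr_desc _ _ _⟩
    have hk₁ : (m' ≫ pushout.inr g m) ≫ k₁ = g' ≫ f' := by rw [Category.assoc, hr, h₂]
    have hD : D (pushout g m) := hpush _ _ (ha j) hd ht
    refine ⟨pushout (m' ≫ pushout.inr g m) g', hpush _ _ (ha j') hD hd',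
      pushout.inl g m ≫ pushout.inl _ _, pushout.inr _ _, pushout.desc k₁ f' hk₁,
      by rw [Category.assoc, pushout.inl_desc, hl], pushout.inr_desc _ _ _, ?_⟩
    rw [← key, ← key, ← (e j).homEquiv_comp, ← (e j').homEquiv_comp, ← pushout.condition,
      pushout.condition_assoc]
    simp only [Category.assoc]
    rw [(e j).homEquiv_comp, (e j').homEquiv_comp, key, key, h₃]

/-- Equalizers of functors generated by `D` are generated by `D`. -/
theorem GeneratedBy.equalizer {D : ObjectProperty C} [HasCoequalizers C]
    [D.IsClosedUnderColimitsOfShape WalkingParallelPair] {E P Q : C ⥤ Type v}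
    (hP : GeneratedBy D P) (hQ : GeneratedBy D Q) (i : E ⟶ P) (α β : P ⟶ Q)
    (hi : ∀ c, Function.Injective (i.app c))
    (hE : ∀ (c : C) (x : P.obj c), α.app c x = β.app c x ↔ ∃ y, i.app c y = x) :
    GeneratedBy D E where
  cover c z := by
    obtain ⟨d, hd, x, f, hx⟩ := hP.cover c (i.app c z)
    have h : Q.map f (α.app d x) = Q.map f (β.app d x) := by
      rw [← NatTrans.naturality_apply, ← NatTrans.naturality_apply, hx]
      exact (hE c _).2 ⟨z, rfl⟩
    -- Although both legs to `c` are `f`, the maps `m` and `m'` may differ. Coequalizing them makes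
    -- the images of `x` under `α` and `β` agree over an object of `D`, so `x` lifts to `E` there.
    obtain ⟨t, ht, m, m', k, hm, hm', e⟩ := hQ.join c d d hd hd _ _ f f h
    have hD : D (coequalizer m m') := D.prop_colimit _ (by rintro (_ | _) <;> assumption)
    let u : d ⟶ coequalizer m m' := m ≫ coequalizer.π m m'
    have hu : u = m' ≫ coequalizer.π m m' := coequalizer.condition m m'
    obtain ⟨y, hy⟩ := (hE _ (P.map u x)).1 (by
      rw [NatTrans.naturality_apply, NatTrans.naturality_apply]
      nth_rw 2 [hu]
      rw [Functor.map_comp_apply, e, Functor.map_comp_apply])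
    refine ⟨_, hD, y, coequalizer.desc k (hm.trans hm'.symm), hi c ?_⟩
    rw [NatTrans.naturality_apply, hy, ← Functor.map_comp_apply, ← hx]
    simp [u, hm]
  join c d d' hd hd' x x' f f' h := by
    obtain ⟨t, ht, m, m', k, hm, hm', e⟩ := hP.join c d d' hd hd' (i.app d x) (i.app d' x') f f' (by
      rw [← NatTrans.naturality_apply, ← NatTrans.naturality_apply, h])
    refine ⟨t, ht, m, m', k, hm, hm', hi t ?_⟩
    rw [NatTrans.naturality_apply, NatTrans.naturality_apply, e]

/-- One class `D` must serve both functors, so it is the closure of the corepresenting objects of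
`P` and `Q` together. Pushouts make `D` generate `P` and `Q`; coequalizers pass this on to `E`. -/
theorem IsSmallFunctor.equalizer [HasPushouts C] [HasCoequalizers C] {E P Q : C ⥤ Type v}
    (hP : IsSmallFunctor P) (hQ : IsSmallFunctor Q) (i : E ⟶ P) (α β : P ⟶ Q)
    (hi : ∀ c, Function.Injective (i.app c))
    (hE : ∀ (c : C) (x : P.obj c), α.app c x = β.app c x ↔ ∃ y, i.app c y = x) :
    IsSmallFunctor E := by
  obtain ⟨J, _, p, hp⟩ := hP
  obtain ⟨K, _, q, hq⟩ := hQ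
  choose a e using fun j => (hp j).has_corepresentation
  choose a' e' using fun j => (hq j).has_corepresentation
  -- Both shapes enter one family, so that the closure is taken under pushouts and coequalizers
  -- simultaneously.
  let shape (s : Bool) : Type := match s with
    | true => WalkingSpan
    | false => WalkingParallelPair
  let _ (s : Bool) : SmallCategory (shape s) := match s with
    | true => inferInstanceAs (SmallCategory WalkingSpan)
    | false => inferInstanceAs (SmallCategory WalkingParallelPair)
  let D₀ : ObjectProperty C := .ofObj (Sum.elim a a')
  let D : ObjectProperty C := D₀.colimitsClosure shape
  have (s : Bool) : Small.{v} (shape s) := by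
    cases s
    · exact inferInstanceAs (Small.{v} WalkingParallelPair)
    · exact inferInstanceAs (Small.{v} WalkingSpan)
  have : D.IsClosedUnderColimitsOfShape WalkingSpan :=
    D₀.instIsClosedUnderColimitsOfShapeColimitsClosure shape true
  have : D.IsClosedUnderColimitsOfShape WalkingParallelPair :=
    D₀.instIsClosedUnderColimitsOfShapeColimitsClosure shape false
  have : ObjectProperty.EssentiallySmall.{v} D := inferInstance
  have hP := GeneratedBy.of_presentation p a (fun j => (e j).some) D
    (fun j => D₀.le_colimitsClosure shape _ ⟨Sum.inl j⟩)
  have hQ := GeneratedBy.of_presentation q a' (fun j => (e' j).some) D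
    (fun j => D₀.le_colimitsClosure shape _ ⟨Sum.inr j⟩)
  exact (hP.equalizer hQ i α β hi hE).isSmallFunctor

end Closure

/-! ### Restriction along right adjoints. -/

section Adjunction

variable {A : Type u₁} [Category.{v} A] {C : Type u₂} [Category.{v} C]

/-- Precomposition with a right adjoint preserves small functors. -/
theorem IsSmallFunctor.precomp {P : A ⥤ Type v} (hP : IsSmallFunctor P) {F : A ⥤ C} {U : C ⥤ A}
    (adj : F ⊣ U) : IsSmallFunctor (U ⋙ P) := by
  obtain ⟨J, _, p, hp⟩ := hP
  -- Precomposition with `U` preserves colimits, and `A(a, U-) ≅ C(Fa, -)`.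
  refine ⟨J, inferInstance, p.map ((Functor.whiskeringLeft C A (Type v)).obj U), fun j => ?_⟩
  obtain ⟨a, ⟨e⟩⟩ := (hp j).has_corepresentation
  exact ((adj.corepresentableBy a).ofIso (Functor.isoWhiskerLeft U e.toIso)).isCorepresentable

end Adjunction

/-! ### Lifting representable smallness to algebras. -/

section Lift

variable {A : Type u₁} [Category.{v} A] {B : Type u₂} [Category.{v} B]

/-- A lax transformation of monads over a representably small functor lifts it to a representably
small functor, if the category of algebras of the source has enough colimits. -/
theorem LaxTransformation.lift_representablySmall {T : Monad A} {S : Monad B} {G : A ⥤ B}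
    (L : LaxTransformation T S G) (hG : RepresentablySmall G) [HasPushouts T.Algebra]
    [HasCoequalizers T.Algebra] : RepresentablySmall L.lift := by
  intro X
  let Q (b : B) : T.Algebra ⥤ Type v := T.forget ⋙ G ⋙ coyoneda.obj (Opposite.op b)
  have hQ (b : B) : IsSmallFunctor (Q b) := (hG b).precomp T.adj
  let i : L.lift ⋙ coyoneda.obj (Opposite.op X) ⟶ Q X.A := { app Y := ↾fun f => f.f }
  -- `α` and `β` are the two sides of the algebra morphism square, so they agree exactly on the
  -- morphisms of algebras.
  let α : Q X.A ⟶ Q (S.obj X.A) :=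
    { app Y := ↾fun f => S.map f ≫ L.φ.app Y.A ≫ G.map Y.a
      naturality Y Z g := by
        ext f
        have h := L.φ.naturality g.f
        simp only [Functor.comp_map] at h
        have aux (f : X.A ⟶ G.obj Y.A) : S.map (f ≫ G.map g.f) ≫ L.φ.app Z.A ≫ G.map Z.a =
            (S.map f ≫ L.φ.app Y.A ≫ G.map Y.a) ≫ G.map g.f := by
          rw [S.map_comp, Category.assoc, reassoc_of% h, Category.assoc, Category.assoc,
            ← G.map_comp, g.h, G.map_comp]
        exact aux f }
  let β : Q X.A ⟶ Q (S.obj X.A) :=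
    { app Y := ↾fun f => X.a ≫ f
      naturality Y Z g := by
        ext f
        exact (Category.assoc X.a f (G.map g.f)).symm }
  refine (hQ _).equalizer (hQ _) i α β (fun Y f g h => Monad.Algebra.Hom.ext h)
    fun Y f => ⟨fun h => ?_, ?_⟩
  · exact ⟨⟨f, h⟩, rfl⟩
  · rintro ⟨g, rfl⟩
    exact g.h

end Lift

end PushforwardMonad

/-! ### The main theorem. -/

theorem mainTheorem11 {A : Type u₁} [Category.{v} A] {B : Type u₂} [Category.{v} B]
    (G : A ⥤ B) (hG : PushforwardMonad.RepresentablySmall G) (hB : HasLimits B)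
    (T : Monad A) (hT : PushforwardMonad.HasFiniteConnectedColimits T.Algebra) :
    G.HasRightKanExtension (T.toFunctor ⋙ G) ∧
    ∀ (R : B ⥤ B) (ε : G ⋙ R ⟶ T.toFunctor ⋙ G) [R.IsRightKanExtension ε],
      HasLimits (PushforwardMonad.pushforward G T R ε).Algebra ∧
      PushforwardMonad.RepresentablySmall (PushforwardMonad.pushforwardLift G T R ε) ∧
      ∀ T' : Monad T.Algebra,
        (PushforwardMonad.pushforwardLift G T R ε).HasRightKanExtension
          (T'.toFunctor ⋙ PushforwardMonad.pushforwardLift G T R ε) := by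
  refine ⟨hG.hasRightKanExtension _, fun R ε _ => ?_⟩
  -- Spans and parallel pairs are the only finite connected shapes needed.
  have : HasPushouts T.Algebra := hT WalkingSpan
  have : HasCoequalizers T.Algebra := hT WalkingParallelPair
  have hlim : HasLimits (PushforwardMonad.pushforward G T R ε).Algebra :=
    hasLimits_of_hasLimits_createsLimits (PushforwardMonad.pushforward G T R ε).forget
  have hsmall : PushforwardMonad.RepresentablySmall (PushforwardMonad.pushforwardLift G T R ε) :=
    (PushforwardMonad.counitLax G T R ε).lift_representablySmall hG
  exact ⟨hlim, hsmall, fun T' => hsmall.hasRightKanExtension _⟩
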